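/- Let $\mathcal D$ be the collection of dyadic intervals $[(k-1)2^{-m},k2^{-m})$, $m\in\mathbb N_0$, $1\le k\le 2^m$, and for $I\in\mathcal D$ with left half $I_0$ and right half $I_1$ let $h_I=\chi_{I_0}-\chi_{I_1}$ be the $L^\infty$-normalized Haar function. Let $SL^\infty$ be the real Banach space of all $f=\sum_{I\in\mathcal D}a_Ih_I\in L^2$ (identified with their real Haar coefficients) such that $$\|f\|_{SL^\infty}=\Big\|\Big(\sum_{I\in\mathcal D}a_I^2h_I^2\Big)^{1/2}\Big\|_{L^\infty}<\infty,$$ and for $n\in\mathbb N_0$ let $SL^\infty_n=\operatorname{span}\{h_I: I\in\mathcal D,\ |I|\ge 2^{-n}\}\subset SL^\infty$, with the norm of $SL^\infty$. An operator is a bounded linear map. **Theorem.** Let $n\in\mathbb N_0$ and $\Gamma,\eta>0$. Then there exists an integer $N=N(n,\Gamma,\eta)\in\mathbb N_0$ such that for every operator $T:SL^\infty_N\to SL^\infty_N$ with $\|T\|\le\Gamma$, the following holds for $H=T$ or for $H=\mathrm{Id}_{SL^\infty_N}-T$: there are operators $R:SL^\infty_n\to SL^\infty_N$ and $S:SL^\infty_N\to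 SL^\infty_n$ such that $$SHR=\mathrm{Id}_{SL^\infty_n}\qquad\text{and}\qquad \|R\|\,\|S\|\le 2+\eta.$$ -/

import Mathlib

open MeasureTheory
open scoped ENNReal

/-- Index of the dyadic intervals in `[0,1)`: the pair `⟨n, k⟩` with `k < 2 ^ n`
stands for `[k 2⁻ⁿ, (k+1) 2⁻ⁿ)`. -/
abbrev DyadicInt : Type := Σ n : ℕ, Fin (2 ^ n)

namespace DyadicInt

/-- The dyadic interval itself. -/
def toSet (I : DyadicInt) : Set ℝ :=
  Set.Ico ((I.2 : ℝ) / 2 ^ I.1) (((I.2 : ℝ) + 1) / 2 ^ I.1)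

/-- The left half of a dyadic interval. -/
def left (I : DyadicInt) : DyadicInt :=
  ⟨I.1 + 1, ⟨2 * (I.2 : ℕ), by have := I.2.isLt; rw [pow_succ]; omega⟩⟩

/-- The right half of a dyadic interval. -/
def right (I : DyadicInt) : DyadicInt :=
  ⟨I.1 + 1, ⟨2 * (I.2 : ℕ) + 1, by have := I.2.isLt; rw [pow_succ]; omega⟩⟩

/-- The `L^∞`-normalized Haar function `h_I`. -/
noncomputable def haar (I : DyadicInt) (x : ℝ) : ℝ :=
  (I.left.toSet).indicator (fun _ => 1) x - (I.right.toSet).indicator (fun _ => 1) x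

end DyadicInt

/-- The square function `(∑_I a_I² h_I²)^{1/2}` of the (formal) series `∑_I a_I h_I`,
with values in `[0,∞]`. -/
noncomputable def squareFunction (a : DyadicInt → ℝ) (x : ℝ) : ℝ≥0∞ :=
  (∑' I : DyadicInt, ENNReal.ofReal (a I ^ 2 * I.haar x ^ 2)) ^ (1 / 2 : ℝ)

/-- The `L^∞([0,1))` norm of the square function, with values in `[0,∞]`. -/
noncomputable def slENorm (a : DyadicInt → ℝ) : ℝ≥0∞ :=
  essSup (squareFunction a) (volume.restrict (Set.Ico (0 : ℝ) 1))

theorem squareFunction_eq (a : DyadicInt → ℝ) (x : ℝ) :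
    squareFunction a x =
      (∫⁻ I, (‖a I * I.haar x‖ₑ) ^ (2 : ℝ) ∂(@Measure.count DyadicInt ⊤)) ^ (1 / 2 : ℝ) := by
  let _ : MeasurableSpace DyadicInt := ⊤
  rw [squareFunction, lintegral_count]
  congr 1
  refine tsum_congr fun I => ?_
  rw [← mul_pow, Real.enorm_eq_ofReal_abs, ← sq_abs, ENNReal.ofReal_pow (abs_nonneg _)]
  norm_cast

theorem squareFunction_zero (x : ℝ) : squareFunction 0 x = 0 := by
  simp [squareFunction]

theorem squareFunction_add_le (a b : DyadicInt → ℝ) (x : ℝ) :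
    squareFunction (a + b) x ≤ squareFunction a x + squareFunction b x := by
  let _ : MeasurableSpace DyadicInt := ⊤
  simp only [squareFunction_eq]
  refine le_trans ?_ (ENNReal.lintegral_Lp_add_le (p := 2) (μ := Measure.count)
    (f := fun I : DyadicInt => ‖a I * I.haar x‖ₑ) (g := fun I : DyadicInt => ‖b I * I.haar x‖ₑ)
    (measurable_from_top).aemeasurable (measurable_from_top).aemeasurable (by norm_num))
  gcongr with I
  simp only [Pi.add_apply, add_mul]
  exact enorm_add_le _ _

theorem squareFunction_smul (c : ℝ) (a : DyadicInt → ℝ) (x : ℝ) :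
    squareFunction (c • a) x = ENNReal.ofReal |c| * squareFunction a x := by
  have h : ∀ I : DyadicInt, ENNReal.ofReal ((c • a) I ^ 2 * I.haar x ^ 2) =
      ENNReal.ofReal (|c| ^ 2) * ENNReal.ofReal (a I ^ 2 * I.haar x ^ 2) := fun I => by
    rw [← ENNReal.ofReal_mul (by positivity), sq_abs, Pi.smul_apply, smul_eq_mul]
    congr 1
    ring
  simp only [squareFunction, h]
  rw [ENNReal.tsum_mul_left, ENNReal.mul_rpow_of_nonneg _ _ (by norm_num),
    ENNReal.ofReal_pow (abs_nonneg _), ← ENNReal.rpow_natCast, ← ENNReal.rpow_mul]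
  norm_num

theorem slENorm_zero : slENorm 0 = 0 := by
  have : squareFunction 0 = 0 := funext squareFunction_zero
  rw [slENorm, this]
  exact le_antisymm (essSup_le_of_ae_le 0 (Filter.Eventually.of_forall fun _ => le_refl _)) zero_le

theorem slENorm_add_le (a b : DyadicInt → ℝ) : slENorm (a + b) ≤ slENorm a + slENorm b := by
  refine le_trans (essSup_mono_ae (Filter.Eventually.of_forall (squareFunction_add_le a b))) ?_
  exact ENNReal.essSup_add_le _ _

theorem slENorm_smul (c : ℝ) (a : DyadicInt → ℝ) :
    slENorm (c • a) = ENNReal.ofReal |c| * slENorm a := by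
  have : squareFunction (c • a) = fun x => ENNReal.ofReal |c| * squareFunction a x :=
    funext (squareFunction_smul c a)
  rw [slENorm, this, ENNReal.essSup_const_mul]
  rfl

theorem DyadicInt.haar_sq_of_mem (I : DyadicInt) {x : ℝ} (hx : x ∈ I.toSet) : I.haar x ^ 2 = 1 := by
  obtain ⟨n, k, hk⟩ := I
  have h2 : (0 : ℝ) < 2 ^ n := by positivity
  simp only [DyadicInt.toSet, Set.mem_Ico, div_le_iff₀ h2, lt_div_iff₀ h2] at hx
  have h2' : (0 : ℝ) < 2 ^ (n + 1) := by positivity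
  have e : x * 2 ^ (n + 1) = 2 * (x * 2 ^ n) := by ring
  simp only [DyadicInt.haar, DyadicInt.left, DyadicInt.right, DyadicInt.toSet, Set.indicator_apply,
    Set.mem_Ico, div_le_iff₀ h2', lt_div_iff₀ h2', e]
  push_cast
  by_cases h : 2 * (x * 2 ^ n) < 2 * k + 1
  · rw [if_pos ⟨by linarith, h⟩, if_neg (fun h' => absurd h'.1 (not_le.2 h))]
    norm_num
  · rw [if_neg (fun h' => h h'.2), if_pos ⟨not_lt.1 h, by linarith⟩]
    norm_num

theorem DyadicInt.toSet_subset (I : DyadicInt) : I.toSet ⊆ Set.Ico (0 : ℝ) 1 := by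
  obtain ⟨n, k, hk⟩ := I
  have h2 : (0 : ℝ) < 2 ^ n := by positivity
  have hk' : (k : ℝ) + 1 ≤ 2 ^ n := by exact_mod_cast hk
  exact Set.Ico_subset_Ico (by positivity) ((div_le_one h2).2 hk')

theorem DyadicInt.volume_toSet (I : DyadicInt) :
    volume.restrict (Set.Ico (0 : ℝ) 1) I.toSet ≠ 0 := by
  have h2 : (0 : ℝ) < 2 ^ I.1 := by positivity
  rw [Measure.restrict_apply (show MeasurableSet I.toSet from measurableSet_Ico), Set.inter_eq_left.2 I.toSet_subset,
    DyadicInt.toSet, Real.volume_Ico, ← sub_div]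
  simp

theorem abs_le_slENorm (a : DyadicInt → ℝ) (I : DyadicInt) : ENNReal.ofReal |a I| ≤ slENorm a := by
  by_contra! hlt
  have h1 : ∀ᵐ x ∂(volume.restrict (Set.Ico (0 : ℝ) 1)), squareFunction a x ≤ slENorm a :=
    ENNReal.ae_le_essSup _
  refine I.volume_toSet (measure_mono_null (fun x hx => ?_) h1)
  simp only [Set.mem_compl_iff, Set.mem_ofPred_eq, not_le]
  refine lt_of_lt_of_le hlt ?_
  have h3 : ENNReal.ofReal |a I| = (ENNReal.ofReal (a I ^ 2 * I.haar x ^ 2)) ^ (1 / 2 : ℝ) := by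
    rw [I.haar_sq_of_mem hx, mul_one, ← sq_abs, ENNReal.ofReal_pow (abs_nonneg _),
      ← ENNReal.rpow_natCast, ← ENNReal.rpow_mul]
    norm_num
  rw [h3, squareFunction]
  gcongr
  exact ENNReal.le_tsum I

theorem slENorm_single_le (I : DyadicInt) : slENorm (Pi.single I 1) ≤ 1 := by
  refine essSup_le_of_ae_le _ (Filter.Eventually.of_forall fun x => ?_)
  have h1 : ∑' J : DyadicInt, ENNReal.ofReal ((Pi.single I 1 : DyadicInt → ℝ) J ^ 2 * J.haar x ^ 2) =
      ENNReal.ofReal (I.haar x ^ 2) := by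
    rw [tsum_eq_single I]
    · simp
    · intro J hJ
      simp [Pi.single_eq_of_ne hJ]
  have h2 : I.haar x ^ 2 ≤ 1 := by
    by_cases hl : x ∈ I.left.toSet <;> by_cases hr : x ∈ I.right.toSet <;>
      simp [DyadicInt.haar, hl, hr]
  change (∑' J : DyadicInt, ENNReal.ofReal ((Pi.single I 1 : DyadicInt → ℝ) J ^ 2 * J.haar x ^ 2)) ^
    (1 / 2 : ℝ) ≤ 1
  rw [h1]
  exact ENNReal.rpow_le_one (ENNReal.ofReal_le_one.2 h2) (by norm_num)

/-- The coefficient families whose square function is in `L^∞`. Each of them is the family of Haar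
coefficients of a function in `L²`, since `∑_I a_I² |I|` is the integral over `[0,1)` of the
squared square function. -/
noncomputable def slSubmodule : Submodule ℝ (DyadicInt → ℝ) where
  carrier := {a | slENorm a < ∞}
  zero_mem' := by simp [slENorm_zero]
  add_mem' := fun {a b} ha hb =>
    lt_of_le_of_lt (slENorm_add_le a b) (ENNReal.add_lt_top.2 ⟨ha, hb⟩)
  smul_mem' := fun c a ha => by
    simpa only [Set.mem_ofPred_eq, slENorm_smul] using ENNReal.mul_lt_top ENNReal.ofReal_lt_top ha

/-- The space `SL^∞`; an element is identified with the family of its Haar coefficients. (A type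
of its own, so that it carries the topology of the norm below and not that of `DyadicInt → ℝ`.) -/
def SLInfty : Type := slSubmodule

noncomputable instance : AddCommGroup SLInfty := inferInstanceAs (AddCommGroup slSubmodule)

noncomputable instance : Module ℝ SLInfty := inferInstanceAs (Module ℝ slSubmodule)

namespace SLInfty

/-- The family of Haar coefficients of an element of `SL^∞`. -/
def coeff (f : SLInfty) : DyadicInt → ℝ := Subtype.val (p := fun a => a ∈ slSubmodule) f

theorem slENorm_lt_top (f : SLInfty) : slENorm f.coeff < ∞ :=
  Subtype.property (p := fun a => a ∈ slSubmodule) f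

/-- `‖f‖ = ‖(∑_I a_I² h_I²)^{1/2}‖_{L^∞}`. -/
noncomputable instance : Norm SLInfty := ⟨fun f => (slENorm f.coeff).toReal⟩

theorem norm_def (f : SLInfty) : ‖f‖ = (slENorm f.coeff).toReal := rfl

theorem normedSpaceCore : NormedSpace.Core ℝ SLInfty where
  norm_nonneg f := ENNReal.toReal_nonneg
  norm_smul c f := by
    have h : (c • f).coeff = c • f.coeff := rfl
    rw [norm_def, h, slENorm_smul, ENNReal.toReal_mul, ENNReal.toReal_ofReal (abs_nonneg _),
      norm_def, Real.norm_eq_abs]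
  norm_triangle f g := by
    rw [norm_def, norm_def, norm_def,
      ← ENNReal.toReal_add f.slENorm_lt_top.ne g.slENorm_lt_top.ne]
    exact ENNReal.toReal_mono
      (ENNReal.add_lt_top.2 ⟨f.slENorm_lt_top, g.slENorm_lt_top⟩).ne
      (slENorm_add_le f.coeff g.coeff)
  norm_eq_zero_iff f := by
    constructor
    · intro h
      have h0 : slENorm f.coeff = 0 :=
        ((ENNReal.toReal_eq_zero_iff _).1 h).resolve_right f.slENorm_lt_top.ne
      refine Subtype.ext (funext fun I => ?_)
      have h1 := abs_le_slENorm f.coeff I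
      rw [h0] at h1
      exact abs_nonpos_iff.1 (ENNReal.ofReal_eq_zero.1 (le_antisymm h1 (zero_le)))
    · rintro rfl
      have h : (0 : SLInfty).coeff = 0 := rfl
      rw [norm_def, h, slENorm_zero, ENNReal.toReal_zero]

noncomputable instance : NormedAddCommGroup SLInfty := NormedAddCommGroup.ofCore normedSpaceCore

noncomputable instance : NormedSpace ℝ SLInfty := NormedSpace.ofCore normedSpaceCore

/-- The Haar function `h_I` as an element of `SL^∞`. -/
noncomputable def haar (I : DyadicInt) : SLInfty :=
  (⟨Pi.single I 1, lt_of_le_of_lt (slENorm_single_le I) ENNReal.one_lt_top⟩ : slSubmodule)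

end SLInfty

/-- `SL^∞_n`, the span of the `h_I` with `|I| ≥ 2⁻ⁿ`, normed as a subspace of `SL^∞`. -/
noncomputable def SLInftyN (n : ℕ) : Submodule ℝ SLInfty :=
  Submodule.span ℝ (SLInfty.haar '' {I : DyadicInt | I.1 ≤ n})

/-! The norm of `SL^∞` is the supremum, over chains of dyadic intervals with a common point, of the
ℓ² norms of the coefficients. It sees only inclusions and not lengths, so single Haar functions
indexed by a copy of the tree of generations `≤ n` inside the tree of generations `≤ N` span an
isometric copy of `SL^∞_n`, and reading off their coefficients is a contraction. The copy need only
send the halves of an interval into the halves of its image.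

The copy must make the matrix of `H` almost diagonal, with diagonal at least `1/2`. Since `‖T‖ ≤ Γ`,
a given interval has boundedly many partners on any branch with an entry of size `δ` in either
direction (`fewBad_interact`). A greedy choice in breadth-first order avoids them whenever
candidates are frequent on branches. Either intervals with diagonal entry of `T` at least `1/2` are
frequent everywhere near the root, or they are scarce below some interval, where the others are then
frequent and serve `Id - T` (`exists_monochromatic`).

Dividing by the diagonal costs a factor `2`; a Neumann series removes the small off-diagonal error
and costs the remaining `η` (`exists_factorization`). -/

/-! ### The dyadic tree -/

namespace DyadicInt

/-- The right (`b = true`) or left (`b = false`) half of a dyadic interval. -/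
def child (I : DyadicInt) (b : Bool) : DyadicInt := bif b then I.right else I.left

/-- The position of a dyadic interval in the breadth-first enumeration, starting with `1`. -/
def enc (I : DyadicInt) : ℕ := 2 ^ I.1 + I.2

theorem child_fst (I : DyadicInt) (b : Bool) : (I.child b).1 = I.1 + 1 := by
  cases b <;> rfl

theorem enc_child (I : DyadicInt) (b : Bool) : (I.child b).enc = 2 * I.enc + b.toNat := by
  cases b <;> simp only [child, enc, left, right, cond_true, cond_false, Bool.toNat_true,
    Bool.toNat_false, pow_succ] <;> omega

theorem enc_pos (I : DyadicInt) : 0 < I.enc := Nat.add_pos_left (by positivity) _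

theorem enc_lt (I : DyadicInt) : I.enc < 2 ^ (I.1 + 1) := by
  have := I.2.isLt
  rw [enc, pow_succ]
  omega

theorem ext_val {I K : DyadicInt} (h : I.1 = K.1) (h' : (I.2 : ℕ) = K.2) : I = K := by
  obtain ⟨n, k⟩ := I
  obtain ⟨m, l⟩ := K
  obtain rfl : n = m := h
  obtain rfl : k = l := Fin.ext h'
  rfl

theorem exists_eq_child (K : DyadicInt) (h : K.1 ≠ 0) : ∃ I b, K = child I b := by
  obtain ⟨n, k, hk⟩ := K
  obtain _ | n := n
  · exact absurd rfl h
  have hk' : k / 2 < 2 ^ n := by rw [pow_succ] at hk; omega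
  refine ⟨⟨n, k / 2, hk'⟩, decide (k % 2 = 1), ?_⟩
  by_cases h2 : k % 2 = 1
  · simp only [h2, decide_true, child, cond_true]
    exact ext_val rfl (show k = 2 * (k / 2) + 1 by omega)
  · simp only [h2, decide_false, child, cond_false]
    exact ext_val rfl (show k = 2 * (k / 2) by omega)

theorem mem_toSet_iff {I : DyadicInt} {x : ℝ} :
    x ∈ I.toSet ↔ (I.2 : ℝ) ≤ x * 2 ^ I.1 ∧ x * 2 ^ I.1 < I.2 + 1 := by
  have h2 : (0 : ℝ) < 2 ^ I.1 := by positivity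
  rw [toSet, Set.mem_Ico, div_le_iff₀ h2, lt_div_iff₀ h2]

theorem eq_of_mem {I K : DyadicInt} {x : ℝ} (h : I.1 = K.1) (hI : x ∈ I.toSet)
    (hK : x ∈ K.toSet) : I = K := by
  rw [mem_toSet_iff] at hI hK
  simp only [h] at hI
  have h1 : (I.2 : ℝ) < K.2 + 1 := hI.1.trans_lt hK.2
  have h2 : (K.2 : ℝ) < I.2 + 1 := hK.1.trans_lt hI.2
  have h1' : (I.2 : ℕ) < K.2 + 1 := by exact_mod_cast h1
  have h2' : (K.2 : ℕ) < I.2 + 1 := by exact_mod_cast h2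
  exact ext_val h (by omega)

theorem child_subset (I : DyadicInt) (b : Bool) : (I.child b).toSet ⊆ I.toSet := by
  intro x hx
  rw [mem_toSet_iff] at hx ⊢
  cases b <;> simp only [child, left, right, cond_true, cond_false, pow_succ] at hx <;>
    push_cast at hx <;> constructor <;> linarith [hx.1, hx.2]

theorem child_inj_of_mem {I : DyadicInt} {b b' : Bool} {x : ℝ} (h : x ∈ (I.child b).toSet)
    (h' : x ∈ (I.child b').toSet) : b = b' := by
  have e := eq_of_mem ((child_fst _ _).trans (child_fst _ _).symm) h h'
  have e' := congrArg enc e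
  rw [enc_child, enc_child] at e'
  cases b <;> cases b' <;> simp_all

theorem subset_of_mem {I : DyadicInt} {x : ℝ} (hI : x ∈ I.toSet) (K : DyadicInt)
    (hK : x ∈ K.toSet) (h : I.1 ≤ K.1) : K.toSet ⊆ I.toSet := by
  induction hk : K.1 generalizing K with
  | zero => rw [eq_of_mem (by omega) hI hK]
  | succ k ih =>
    rcases h.eq_or_lt with h | h
    · rw [eq_of_mem h hI hK]
    · obtain ⟨K, b, rfl⟩ := K.exists_eq_child (by omega)
      rw [child_fst] at hk h
      exact (child_subset K b).trans
        (ih K (child_subset K b hK) (by omega) (by omega))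

/-- The intervals of generation at most `n`. -/
def upTo (n : ℕ) : Finset DyadicInt := (Finset.range (n + 1)).sigma fun _ => Finset.univ

theorem mem_upTo {n : ℕ} {I : DyadicInt} : I ∈ upTo n ↔ I.1 ≤ n := by
  simp [upTo]

/-! ### Copies of the finite dyadic tree -/

section Embedding

variable {φ : ℕ → DyadicInt} {n : ℕ}

/-- The map `I ↦ φ (enc I)` sends the halves of an interval of generation below `n` into
the respective halves of its image. -/
def IsEmbedding (φ : ℕ → DyadicInt) (n : ℕ) : Prop :=
  ∀ I : DyadicInt, ∀ b, (I.child b).1 ≤ n →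
    (φ (I.child b).enc).toSet ⊆ ((φ I.enc).child b).toSet

theorem IsEmbedding.subset (hφ : IsEmbedding φ n) {I : DyadicInt} {x : ℝ} (hI : x ∈ I.toSet)
    (K : DyadicInt) (hK : x ∈ K.toSet) (h : I.1 ≤ K.1) (hn : K.1 ≤ n) :
    (φ K.enc).toSet ⊆ (φ I.enc).toSet := by
  induction hk : K.1 generalizing K with
  | zero => rw [eq_of_mem (by omega) hI hK]
  | succ k ih =>
    rcases h.eq_or_lt with h | h
    · rw [eq_of_mem h hI hK]
    · obtain ⟨K, b, rfl⟩ := K.exists_eq_child (by omega)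
      refine ((hφ K b hn).trans (child_subset _ b)).trans ?_
      rw [child_fst] at hk h hn
      exact ih K (child_subset K b hK) (by omega) (by omega) (by omega)

theorem IsEmbedding.eq_of_mem (hφ : IsEmbedding φ n) {y : ℝ} (I K : DyadicInt) (h : I.1 = K.1)
    (hn : K.1 ≤ n) (hI : y ∈ (φ I.enc).toSet) (hK : y ∈ (φ K.enc).toSet) : I = K := by
  induction hk : K.1 generalizing I K with
  | zero =>
    refine ext_val h ?_
    have h1 := I.2.isLt
    have h2 := K.2.isLt
    simp only [h, hk, pow_zero, Nat.lt_one_iff] at h1 h2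
    rw [h1, h2]
  | succ k ih =>
    obtain ⟨K, b, rfl⟩ := K.exists_eq_child (by omega)
    obtain ⟨I, b', rfl⟩ := I.exists_eq_child (by omega)
    have hI' := hφ I b' (by omega) hI
    have hK' := hφ K b hn hK
    rw [child_fst] at hk hn h
    rw [child_fst] at h
    obtain rfl := ih I K (by omega) (by omega) (child_subset _ _ hI') (child_subset _ _ hK')
      (by omega)
    rw [child_inj_of_mem hI' hK']

/-- Images of distinct intervals of one generation are disjoint, so images meeting at a point come
from a chain. With `IsEmbedding.subset`, chains correspond to chains in both directions. -/
theorem IsEmbedding.subset_of_mem (hφ : IsEmbedding φ n) {y : ℝ} {I : DyadicInt}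
    (hI : y ∈ (φ I.enc).toSet) (K : DyadicInt) (hK : y ∈ (φ K.enc).toSet) (h : I.1 ≤ K.1)
    (hn : K.1 ≤ n) : K.toSet ⊆ I.toSet := by
  induction hk : K.1 generalizing K with
  | zero => rw [hφ.eq_of_mem I K (by omega) hn hI hK]
  | succ k ih =>
    rcases h.eq_or_lt with h | h
    · rw [hφ.eq_of_mem I K h hn hI hK]
    · obtain ⟨K, b, rfl⟩ := K.exists_eq_child (by omega)
      refine (child_subset K b).trans ?_
      have hK' := child_subset _ _ (hφ K b hn hK)
      rw [child_fst] at hk h hn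
      exact ih K hK' (by omega) (by omega) (by omega)

end Embedding

/-! ### Greedy selection and the dichotomy -/

section Greedy

variable {bad : DyadicInt → DyadicInt → Prop} {C m : ℕ}

open Classical in
/-- Each interval has at most `C` bad partners on every branch. -/
def FewBad (bad : DyadicInt → DyadicInt → Prop) (C : ℕ) : Prop :=
  ∀ (Q K : DyadicInt) (F : Finset DyadicInt), (∀ J ∈ F, K.toSet ⊆ J.toSet) →
    (F.filter (bad Q)).card ≤ C

/-- Below `P` there is a branch with more than `k` intervals in `c` among its next `L`
generations. -/
def Rich (c : DyadicInt → Prop) (k L : ℕ) (P : DyadicInt) : Prop :=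
  ∃ (K : DyadicInt) (F : Finset DyadicInt), k < F.card ∧
    ∀ J ∈ F, c J ∧ K.toSet ⊆ J.toSet ∧ J.toSet ⊆ P.toSet ∧ J.1 ≤ P.1 + L

theorem Rich.exists_not_bad {c : DyadicInt → Prop} {L i : ℕ} {P : DyadicInt}
    (h : Rich c (m * C) L P) (hbad : FewBad bad C) (φ : ℕ → DyadicInt) (hi : i ≤ m) :
    ∃ J, c J ∧ J.toSet ⊆ P.toSet ∧ J.1 ≤ P.1 + L ∧ ∀ q < i, ¬ bad (φ q) J := by
  classical
  obtain ⟨K, F, hF, hJ⟩ := h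
  -- The `i ≤ m` earlier choices spoil at most `C` members of `F` each, and `F` has more than `m *
  -- C`.
  have hcard : ((Finset.range i).biUnion fun q => F.filter (bad (φ q))).card < F.card := by
    refine (Finset.card_biUnion_le_card_mul _ _ C fun q _ => ?_).trans_lt
      (lt_of_le_of_lt ?_ hF)
    · convert hbad (φ q) K F fun J h => (hJ J h).2.1
    · rw [Finset.card_range]
      exact Nat.mul_le_mul_right C hi
  obtain ⟨J, hJF, hJ'⟩ := Finset.exists_mem_notMem_of_card_lt_card hcard
  obtain ⟨h1, -, h2, h3⟩ := hJ J hJF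
  refine ⟨J, h1, h2, h3, fun q hq hb => hJ' ?_⟩
  exact Finset.mem_biUnion.2 ⟨q, Finset.mem_range.2 hq, Finset.mem_filter.2 ⟨hJF, hb⟩⟩

/-- Position `p` has parent `p / 2` and its parity says which half, so parents are always chosen
earlier. A choice descends at most one generation to the half and `L` more in the search. Positions
`0` and `1` have no parent and are sought directly below `P₀`. -/
theorem exists_greedy {c : DyadicInt → Prop} {L : ℕ} {P₀ : DyadicInt} (hbad : FewBad bad C)
    (hrich : ∀ P : DyadicInt, P.toSet ⊆ P₀.toSet → P.1 ≤ P₀.1 + m * (L + 1) →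
      Rich c (m * C) L P) :
    ∀ i ≤ m, ∃ φ : ℕ → DyadicInt, ∀ p < i, c (φ p) ∧ (φ p).toSet ⊆ P₀.toSet ∧
      (φ p).1 ≤ P₀.1 + (p + 1) * (L + 1) ∧
      (2 ≤ p → (φ p).toSet ⊆ ((φ (p / 2)).child (decide (p % 2 = 1))).toSet) ∧
      ∀ q < p, ¬ bad (φ q) (φ p) := by
  intro i
  induction i with
  | zero => exact fun _ => ⟨fun _ => P₀, fun p hp => absurd hp (Nat.not_lt_zero p)⟩
  | succ i ih =>
    intro hi
    obtain ⟨φ, hφ⟩ := ih (by omega)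
    obtain ⟨P, hP, hP', hPL, hPc⟩ : ∃ P : DyadicInt, P.toSet ⊆ P₀.toSet ∧
        P.1 ≤ P₀.1 + m * (L + 1) ∧ P.1 + L ≤ P₀.1 + (i + 1) * (L + 1) ∧
        (2 ≤ i → P = (φ (i / 2)).child (decide (i % 2 = 1))) := by
      by_cases h2 : 2 ≤ i
      · obtain ⟨-, h3, h4, -⟩ := hφ (i / 2) (by omega)
        have h5 : (i / 2 + 1) * (L + 1) ≤ i * (L + 1) := Nat.mul_le_mul_right _ (by omega)
        have h6 : (i + 1) * (L + 1) ≤ m * (L + 1) := Nat.mul_le_mul_right _ hi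
        have h7 : (i + 1) * (L + 1) = i * (L + 1) + (L + 1) := by ring
        refine ⟨_, (child_subset _ _).trans h3, ?_, ?_, fun _ => rfl⟩ <;> rw [child_fst] <;> omega
      · refine ⟨P₀, subset_rfl, by omega, ?_, fun h => absurd h h2⟩
        have h7 : (i + 1) * (L + 1) = i * (L + 1) + (L + 1) := by ring
        omega
    obtain ⟨J, hJc, hJP, hJL, hJbad⟩ :=
      (hrich P hP hP').exists_not_bad hbad φ (i := i) (by omega)
    have hlt : ∀ p < i, Function.update φ i J p = φ p := fun p hp =>
      Function.update_of_ne hp.ne _ _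
    refine ⟨Function.update φ i J, fun p hp => ?_⟩
    rcases Nat.lt_succ_iff_lt_or_eq.1 hp with hp | rfl
    · obtain ⟨h1, h2, h3, h4, h5⟩ := hφ p hp
      rw [hlt p hp, hlt (p / 2) (by omega)]
      exact ⟨h1, h2, h3, h4, fun q hq => by rw [hlt q (by omega)]; exact h5 q hq⟩
    · rw [Function.update_self]
      refine ⟨hJc, hJP.trans hP, by omega, fun h2 => ?_, fun q hq => ?_⟩
      · rw [hlt (p / 2) (by omega), ← hPc h2]
        exact hJP
      · rw [hlt q hq]
        exact hJbad q hq

theorem left_iterate (P : DyadicInt) (j : ℕ) :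
    (left^[j] P).1 = P.1 + j ∧ (left^[j] P).toSet ⊆ P.toSet := by
  induction j with
  | zero => exact ⟨rfl, subset_rfl⟩
  | succ j ih =>
    rw [Function.iterate_succ_apply']
    exact ⟨by rw [← add_assoc, ← ih.1]; rfl, (child_subset _ false).trans ih.2⟩

theorem left_iterate_subset (P : DyadicInt) {i j : ℕ} (h : i ≤ j) :
    (left^[j] P).toSet ⊆ (left^[i] P).toSet := by
  obtain ⟨k, rfl⟩ := Nat.exists_eq_add_of_le' h
  rw [Function.iterate_add_apply]
  exact (left_iterate _ k).2

/-- If no branch below `P` meets `c` often, then the leftmost branches meet its complement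
often. -/
theorem rich_not_of_not_rich {c : DyadicInt → Prop} {k L L' : ℕ} {P Q : DyadicInt}
    (h : ¬ Rich c k L P) (hQ : Q.toSet ⊆ P.toSet) (hL : Q.1 + (2 * k + 1) ≤ P.1 + L)
    (hL' : 2 * k + 1 ≤ L') : Rich (fun J => ¬ c J) k L' Q := by
  classical
  set F : Finset DyadicInt := (Finset.range (2 * k + 1)).image fun j => left^[j] Q with hF
  have hcard : F.card = 2 * k + 1 := by
    rw [hF, Finset.card_image_of_injective, Finset.card_range]
    intro i j hij
    have h1 := (left_iterate Q i).1
    rw [show left^[i] Q = left^[j] Q from hij, (left_iterate Q j).1] at h1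
    omega
  have hmem : ∀ J ∈ F, (left^[2 * k + 1] Q).toSet ⊆ J.toSet ∧ J.toSet ⊆ Q.toSet ∧
      J.1 ≤ Q.1 + (2 * k + 1) := by
    intro J hJ
    obtain ⟨j, hj, rfl⟩ := Finset.mem_image.1 hJ
    rw [Finset.mem_range] at hj
    refine ⟨left_iterate_subset Q hj.le, (left_iterate Q j).2, ?_⟩
    rw [(left_iterate Q j).1]
    omega
  -- More than `k` members of `c` on this branch would witness richness of `P`, so of the `2 * k +
  -- 1` intervals at least `k + 1` lie outside `c`.
  have hc : (F.filter c).card ≤ k := by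
    by_contra! hlt
    refine h ⟨left^[2 * k + 1] Q, F.filter c, hlt, fun J hJ => ?_⟩
    obtain ⟨hJF, hJc⟩ := Finset.mem_filter.1 hJ
    obtain ⟨h1, h2, h3⟩ := hmem J hJF
    exact ⟨hJc, h1, h2.trans hQ, by omega⟩
  have hsum := F.card_filter_add_card_filter_not c
  refine ⟨left^[2 * k + 1] Q, F.filter fun J => ¬ c J, by omega, fun J hJ => ?_⟩
  obtain ⟨hJF, hJc⟩ := Finset.mem_filter.1 hJ
  obtain ⟨h1, h2, h3⟩ := hmem J hJF
  exact ⟨hJc, h1, h2, by omega⟩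

theorem exists_monochromatic (C m : ℕ) : ∃ N : ℕ, ∀ (bad : DyadicInt → DyadicInt → Prop)
    (c : DyadicInt → Prop), FewBad bad C → ∃ φ : ℕ → DyadicInt,
      ((∀ p < m, c (φ p)) ∨ ∀ p < m, ¬ c (φ p)) ∧ ∀ p < m, (φ p).1 ≤ N ∧
      (2 ≤ p → (φ p).toSet ⊆ ((φ (p / 2)).child (decide (p % 2 = 1))).toSet) ∧
      ∀ q < p, ¬ bad (φ q) (φ p) := by
  -- `L'` is the search depth for the complement of `c`. `L` leaves room below a failing `P` for
  -- that whole greedy construction and one more leftmost branch. The two summands of the bound are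
  -- the depth of `P` and of the construction below it.
  set L' := 2 * (m * C) + 1 with hL'
  set L := (m + 1) * (L' + 1) with hL
  refine ⟨m * (L + 1) + m * (L' + 1), fun bad c hbad => ?_⟩
  have hmul : ∀ p < m, ∀ l, (p + 1) * (l + 1) ≤ m * (l + 1) := fun p hp l =>
    Nat.mul_le_mul_right _ hp
  by_cases hrich : ∀ P : DyadicInt, P.1 ≤ m * (L + 1) → Rich c (m * C) L P
  · obtain ⟨φ, hφ⟩ := exists_greedy (P₀ := ⟨0, 0⟩) hbad (c := c) (L := L)
      (fun P _ h => hrich P (by simpa using h)) m le_rfl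
    refine ⟨φ, Or.inl fun p hp => (hφ p hp).1, fun p hp => ?_⟩
    obtain ⟨-, -, h3, h4, h5⟩ := hφ p hp
    have := hmul p hp L
    exact ⟨by simp only [zero_add] at h3; omega, h4, h5⟩
  · push Not at hrich
    obtain ⟨P, hP, hPr⟩ := hrich
    obtain ⟨φ, hφ⟩ := exists_greedy (P₀ := P) hbad (c := fun J => ¬ c J) (L := L')
      (fun Q hQ h => rich_not_of_not_rich hPr hQ (by
        have : (m + 1) * (L' + 1) = m * (L' + 1) + (L' + 1) := by ring
        omega) hL'.ge) m le_rfl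
    refine ⟨φ, Or.inr fun p hp => (hφ p hp).1, fun p hp => ?_⟩
    obtain ⟨-, -, h3, h4, h5⟩ := hφ p hp
    have := hmul p hp L'
    exact ⟨by omega, h4, h5⟩

end Greedy

end DyadicInt

/-! ### The norm as a supremum of ℓ² norms along branches -/

theorem DyadicInt.haar_sq (I : DyadicInt) (x : ℝ) [Decidable (x ∈ I.toSet)] :
    I.haar x ^ 2 = if x ∈ I.toSet then 1 else 0 := by
  split_ifs with h
  · exact I.haar_sq_of_mem h
  · have hl : x ∉ I.left.toSet := fun h' => h (I.child_subset false h')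
    have hr : x ∉ I.right.toSet := fun h' => h (I.child_subset true h')
    simp [haar, hl, hr]

theorem slENorm_le {a : DyadicInt → ℝ} {B : ℝ} (hB : 0 ≤ B)
    (h : ∀ (x : ℝ) (F : Finset DyadicInt), (∀ J ∈ F, x ∈ J.toSet) → ∑ J ∈ F, a J ^ 2 ≤ B ^ 2) :
    slENorm a ≤ ENNReal.ofReal B := by
  classical
  refine essSup_le_of_ae_le _ (Filter.Eventually.of_forall fun x => ?_)
  have h1 : ∑' I : DyadicInt, ENNReal.ofReal (a I ^ 2 * I.haar x ^ 2) ≤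
      ENNReal.ofReal B ^ (2 : ℝ) := by
    rw [ENNReal.tsum_eq_iSup_sum]
    refine iSup_le fun F => ?_
    rw [← ENNReal.ofReal_sum_of_nonneg fun _ _ => by positivity,
      show (2 : ℝ) = ((2 : ℕ) : ℝ) by norm_num, ENNReal.rpow_natCast, ← ENNReal.ofReal_pow hB]
    refine ENNReal.ofReal_le_ofReal ?_
    simp only [DyadicInt.haar_sq, mul_ite, mul_one, mul_zero]
    rw [← Finset.sum_filter]
    exact h x _ fun J hJ => (Finset.mem_filter.1 hJ).2
  calc squareFunction a x ≤ (ENNReal.ofReal B ^ (2 : ℝ)) ^ (1 / 2 : ℝ) :=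
        ENNReal.rpow_le_rpow h1 (by norm_num)
    _ = ENNReal.ofReal B := by rw [← ENNReal.rpow_mul]; norm_num

namespace SLInfty

/-- The Haar coefficient at `I` as a linear functional. -/
def coeffHom (I : DyadicInt) : SLInfty →ₗ[ℝ] ℝ where
  toFun f := f.coeff I
  map_add' _ _ := rfl
  map_smul' _ _ := rfl

theorem coeff_smul (c : ℝ) (f : SLInfty) (I : DyadicInt) :
    (c • f).coeff I = c * f.coeff I := rfl

theorem coeff_sum {ι : Type*} (F : Finset ι) (f : ι → SLInfty) (I : DyadicInt) :
    (∑ i ∈ F, f i).coeff I = ∑ i ∈ F, (f i).coeff I := map_sum (coeffHom I) f F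

theorem coeff_haar (I J : DyadicInt) : (haar I).coeff J = if J = I then 1 else 0 :=
  Pi.single_apply I 1 J

theorem ext_coeff {f g : SLInfty} (h : ∀ I, f.coeff I = g.coeff I) : f = g :=
  Subtype.ext (funext h)

theorem ofReal_norm_eq (f : SLInfty) : ENNReal.ofReal ‖f‖ = slENorm f.coeff :=
  ENNReal.ofReal_toReal f.slENorm_lt_top.ne

theorem norm_le_of_sum_sq_le {f : SLInfty} {B : ℝ} (hB : 0 ≤ B)
    (h : ∀ (x : ℝ) (F : Finset DyadicInt), (∀ J ∈ F, x ∈ J.toSet) →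
      ∑ J ∈ F, f.coeff J ^ 2 ≤ B ^ 2) : ‖f‖ ≤ B :=
  ENNReal.toReal_le_of_le_ofReal hB (slENorm_le hB h)

/-- All `h_J` with `J ∈ F` have modulus one on `K`, which has positive measure, so the essential
supremum sees the sum. `norm_le_of_sum_sq_le` is the converse estimate. -/
theorem sum_sq_le_norm_sq (f : SLInfty) {K : DyadicInt} {F : Finset DyadicInt}
    (hF : ∀ J ∈ F, K.toSet ⊆ J.toSet) : ∑ J ∈ F, f.coeff J ^ 2 ≤ ‖f‖ ^ 2 := by
  have key : ENNReal.ofReal (∑ J ∈ F, f.coeff J ^ 2) ^ (1 / 2 : ℝ) ≤ slENorm f.coeff := by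
    by_contra! hlt
    refine K.volume_toSet (measure_mono_null (fun x hx => ?_)
      (ENNReal.ae_le_essSup (μ := volume.restrict (Set.Ico (0 : ℝ) 1)) (squareFunction f.coeff)))
    simp only [Set.mem_compl_iff, Set.mem_ofPred_eq, not_le]
    refine lt_of_lt_of_le hlt ?_
    rw [squareFunction]
    gcongr
    rw [ENNReal.ofReal_sum_of_nonneg fun _ _ => by positivity]
    refine le_trans (Finset.sum_le_sum fun J hJ => ?_) (ENNReal.sum_le_tsum F)
    rw [J.haar_sq_of_mem (hF J hJ hx), mul_one]
  rw [← ofReal_norm_eq] at key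
  have h2 := ENNReal.rpow_le_rpow key (show (0 : ℝ) ≤ (2 : ℕ) by norm_num)
  rw [← ENNReal.rpow_mul, ENNReal.rpow_natCast, ← ENNReal.ofReal_pow (norm_nonneg _)] at h2
  rw [show (1 / 2 : ℝ) * (2 : ℕ) = 1 by norm_num, ENNReal.rpow_one] at h2
  exact (ENNReal.ofReal_le_ofReal_iff (by positivity)).1 h2

theorem abs_coeff_le (f : SLInfty) (I : DyadicInt) : |f.coeff I| ≤ ‖f‖ := by
  have := f.sum_sq_le_norm_sq (K := I) (F := {I}) (by simp)
  rw [Finset.sum_singleton] at this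
  exact abs_le_of_sq_le_sq this (norm_nonneg f)

end SLInfty

/-! ### Haar polynomials in the finite-dimensional spaces -/

open SLInfty

/-- The Haar function `h_I` as an element of `SL^∞_N`, or `0` if `I` is too short. -/
noncomputable def haarN (N : ℕ) (I : DyadicInt) : SLInftyN N :=
  if h : I.1 ≤ N then ⟨haar I, Submodule.subset_span ⟨I, h, rfl⟩⟩ else 0

theorem coeff_haarN (N : ℕ) (I J : DyadicInt) :
    (haarN N I : SLInfty).coeff J = if J = I ∧ I.1 ≤ N then 1 else 0 := by
  by_cases h : I.1 ≤ N
  · simp [haarN, h, coeff_haar]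
  · simp only [haarN, h, dif_neg, not_false_eq_true, and_false, if_false]
    rfl

theorem coeff_sum_haarN {N : ℕ} {F : Finset DyadicInt} {c : DyadicInt → ℝ} (J : DyadicInt)
    (β : DyadicInt → DyadicInt) :
    ((∑ I ∈ F, c I • haarN N (β I) : SLInftyN N) : SLInfty).coeff J =
      ∑ I ∈ F, if J = β I ∧ (β I).1 ≤ N then c I else 0 := by
  rw [AddSubmonoidClass.coe_finsetSum, coeff_sum]
  refine Finset.sum_congr rfl fun I _ => ?_
  rw [Submodule.coe_smul, coeff_smul, coeff_haarN, mul_ite, mul_one, mul_zero]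

/-- The norm of a Haar polynomial is at most the supremum of the `ℓ²`-norms along branches. -/
theorem norm_sum_haarN_le {N : ℕ} {F : Finset DyadicInt} {c : DyadicInt → ℝ}
    {β : DyadicInt → DyadicInt} (hβ : Set.InjOn β F) {B : ℝ} (hB : 0 ≤ B)
    (h : ∀ (x : ℝ), ∀ G ⊆ F, (∀ I ∈ G, x ∈ (β I).toSet) → ∑ I ∈ G, c I ^ 2 ≤ B ^ 2) :
    ‖∑ I ∈ F, c I • haarN N (β I)‖ ≤ B := by
  classical
  change ‖((∑ I ∈ F, c I • haarN N (β I) : SLInftyN N) : SLInfty)‖ ≤ B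
  refine norm_le_of_sum_sq_le hB fun x G hG => ?_
  refine le_trans ?_ (h x (F.filter fun I => β I ∈ G) (Finset.filter_subset _ _)
    fun I hI => hG _ (Finset.mem_filter.1 hI).2)
  have h1 : ∀ I ∈ F, ((∑ I ∈ F, c I • haarN N (β I) : SLInftyN N) : SLInfty).coeff (β I) ^ 2 ≤
      c I ^ 2 := by
    intro I hI
    rw [coeff_sum_haarN, Finset.sum_eq_single I]
    · split_ifs
      · exact le_rfl
      · rw [zero_pow two_ne_zero]
        exact sq_nonneg _
    · intro K hK hKI
      exact if_neg fun h => hKI (hβ hK hI h.1.symm)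
    · exact fun h => absurd hI h
  have h0 : ∀ J, J ∉ F.image β →
      ((∑ I ∈ F, c I • haarN N (β I) : SLInftyN N) : SLInfty).coeff J = 0 := by
    intro J hJ
    rw [coeff_sum_haarN]
    exact Finset.sum_eq_zero fun I hI => if_neg fun h =>
      hJ (Finset.mem_image.2 ⟨I, hI, h.1.symm⟩)
  have himg : (F.filter fun I => β I ∈ G).image β ⊆ G := by
    intro J hJ
    obtain ⟨I, hI, rfl⟩ := Finset.mem_image.1 hJ
    exact (Finset.mem_filter.1 hI).2
  rw [← Finset.sum_subset himg, Finset.sum_image]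
  · exact Finset.sum_le_sum fun I hI => h1 I (Finset.mem_filter.1 hI).1
  · exact fun I hI K hK => hβ (Finset.mem_filter.1 hI).1 (Finset.mem_filter.1 hK).1
  · intro J hJ hJ'
    rw [h0 J, zero_pow two_ne_zero]
    intro hJ''
    obtain ⟨I, hI, rfl⟩ := Finset.mem_image.1 hJ''
    exact hJ' (Finset.mem_image.2 ⟨I, Finset.mem_filter.2 ⟨hI, hJ⟩, rfl⟩)

theorem norm_haarN_le (N : ℕ) (I : DyadicInt) : ‖haarN N I‖ ≤ 1 := by
  have := norm_sum_haarN_le (N := N) (F := {I}) (c := fun _ => 1) (β := id)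
    (Set.injOn_id _) zero_le_one (fun x G hG _ => by
      have : (G.card : ℝ) ≤ 1 := by exact_mod_cast Finset.card_le_card hG
      simpa using this)
  simpa using this

theorem coeff_eq_zero {n : ℕ} (f : SLInftyN n) {I : DyadicInt} (h : n < I.1) :
    (f : SLInfty).coeff I = 0 := by
  have hle : SLInftyN n ≤ LinearMap.ker (coeffHom I) := by
    refine Submodule.span_le.2 ?_
    rintro _ ⟨J, hJ, rfl⟩
    change (haar J).coeff I = 0
    rw [coeff_haar, if_neg]
    rintro rfl
    exact absurd hJ (not_le.2 h)
  exact hle f.2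

theorem eq_sum_haarN {n : ℕ} (f : SLInftyN n) :
    f = ∑ I ∈ DyadicInt.upTo n, (f : SLInfty).coeff I • haarN n I := by
  refine Subtype.ext (ext_coeff fun J => ?_)
  refine Eq.trans ?_ (coeff_sum_haarN J id).symm
  by_cases h : J.1 ≤ n
  · rw [Finset.sum_eq_single J]
    · simp [h]
    · exact fun I _ hI => if_neg fun h => hI h.1.symm
    · exact fun h' => absurd (DyadicInt.mem_upTo.2 h) h'
  · rw [coeff_eq_zero f (not_le.1 h)]
    refine (Finset.sum_eq_zero fun I hI => if_neg ?_).symm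
    rintro ⟨rfl, h'⟩
    exact h h'

instance (n : ℕ) : FiniteDimensional ℝ (SLInftyN n) := by
  refine FiniteDimensional.span_of_finite ℝ (Set.Finite.image _ ?_)
  exact (DyadicInt.upTo n).finite_toSet.subset fun I hI => DyadicInt.mem_upTo.2 hI

/-! ### Large matrix entries are few -/

section Entries

variable {N : ℕ} {T : SLInftyN N →L[ℝ] SLInftyN N} {Γ δ : ℝ}

/-- The matrix entry of `T` from `h_J` to `h_K`. -/
noncomputable def entry (T : SLInftyN N →L[ℝ] SLInftyN N) (J K : DyadicInt) : ℝ :=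
  (T (haarN N J) : SLInfty).coeff K

/-- The entries are coefficients of the image of one Haar function, whose norm is at most `Γ`, and
their squares are summed along one branch. -/
theorem card_le_of_le_abs_entry (hδ : 0 < δ) (hT : ‖T‖ ≤ Γ) {J K : DyadicInt}
    {F : Finset DyadicInt} (hF : ∀ I ∈ F, K.toSet ⊆ I.toSet) (h : ∀ I ∈ F, δ ≤ |entry T J I|) :
    (F.card : ℝ) ≤ Γ ^ 2 / δ ^ 2 := by
  have hn : ‖(T (haarN N J) : SLInfty)‖ ≤ Γ :=
    (T.le_opNorm_of_le (norm_haarN_le N J)).trans (by rwa [mul_one])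
  rw [le_div_iff₀ (by positivity), ← nsmul_eq_mul]
  calc F.card • δ ^ 2 ≤ ∑ I ∈ F, (T (haarN N J) : SLInfty).coeff I ^ 2 :=
        Finset.card_nsmul_le_sum _ _ _ fun I hI => by
          rw [← sq_abs (SLInfty.coeff _ I)]
          exact pow_le_pow_left₀ hδ.le (h I hI) 2
    _ ≤ _ := sum_sq_le_norm_sq _ hF
    _ ≤ Γ ^ 2 := pow_le_pow_left₀ (norm_nonneg _) hn 2

/-- Duality: a signed sum of `k` Haar functions has norm at most `√k`, while with the right signs
the coefficient of its image at `J` is at least `k * δ`. Hence `k * δ ≤ Γ * √k`; no branch condition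
is needed. -/
theorem card_le_of_le_abs_entry' (hδ : 0 < δ) (hT : ‖T‖ ≤ Γ) {J : DyadicInt}
    {F : Finset DyadicInt} (h : ∀ I ∈ F, δ ≤ |entry T I J|) :
    (F.card : ℝ) ≤ Γ ^ 2 / δ ^ 2 := by
  have hn : ‖∑ I ∈ F, (SignType.sign (entry T I J) : ℝ) • haarN N (id I)‖ ≤ √F.card := by
    refine norm_sum_haarN_le (Set.injOn_id _) (Real.sqrt_nonneg _) fun x G hG _ => ?_
    rw [Real.sq_sqrt (Nat.cast_nonneg _)]
    have hs : ∀ s : SignType, (s : ℝ) ^ 2 ≤ 1 := by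
      intro s
      cases s <;> simp
    calc _ ≤ ∑ I ∈ G, (1 : ℝ) := Finset.sum_le_sum fun I _ => hs _
      _ ≤ F.card := by
        rw [Finset.sum_const, nsmul_one]
        exact_mod_cast Finset.card_le_card hG
  have hsum : (T (∑ I ∈ F, (SignType.sign (entry T I J) : ℝ) • haarN N (id I)) : SLInfty).coeff J =
      ∑ I ∈ F, |entry T I J| := by
    rw [map_sum, AddSubmonoidClass.coe_finsetSum, coeff_sum]
    refine Finset.sum_congr rfl fun I _ => ?_
    rw [map_smul, Submodule.coe_smul, coeff_smul]
    exact sign_mul_self (entry T I J)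
  have h1 : F.card * δ ≤ Γ * √F.card := by
    rw [← nsmul_eq_mul]
    refine (Finset.card_nsmul_le_sum _ _ _ h).trans ?_
    rw [← hsum]
    refine (le_abs_self _).trans ((abs_coeff_le _ J).trans ?_)
    exact (T.le_opNorm_of_le hn).trans (mul_le_mul_of_nonneg_right hT (Real.sqrt_nonneg _))
  rw [le_div_iff₀ (by positivity)]
  have hΓ : 0 ≤ Γ := (norm_nonneg T).trans hT
  have h2 := pow_le_pow_left₀ (by positivity) h1 2
  rw [mul_pow, mul_pow, Real.sq_sqrt (Nat.cast_nonneg _)] at h2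
  rcases Nat.eq_zero_or_pos F.card with h0 | h0
  · rw [h0]
    simpa using sq_nonneg Γ
  · have h0' : (0 : ℝ) < F.card := by exact_mod_cast h0
    nlinarith

/-- `J` and `Q` interact strongly under `T`. -/
def Interact (T : SLInftyN N →L[ℝ] SLInftyN N) (δ : ℝ) (Q J : DyadicInt) : Prop :=
  J = Q ∨ δ ≤ |entry T Q J| ∨ δ ≤ |entry T J Q|

/-- One partner is the interval itself; the floors count the large entries from `Q` and into `Q`. -/
theorem fewBad_interact (hδ : 0 < δ) (hT : ‖T‖ ≤ Γ) :
    DyadicInt.FewBad (Interact T δ) (1 + (⌊Γ ^ 2 / δ ^ 2⌋₊ + ⌊Γ ^ 2 / δ ^ 2⌋₊)) := by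
  classical
  intro Q K F hF
  have hsub : F.filter (Interact T δ Q) ⊆ (F.filter fun J => J = Q) ∪
      ((F.filter fun J => δ ≤ |entry T Q J|) ∪ F.filter fun J => δ ≤ |entry T J Q|) := by
    intro J hJ
    obtain ⟨hJF, h⟩ := Finset.mem_filter.1 hJ
    rw [Finset.mem_union, Finset.mem_union, Finset.mem_filter, Finset.mem_filter,
      Finset.mem_filter]
    exact h.imp (⟨hJF, ·⟩) (Or.imp (⟨hJF, ·⟩) (⟨hJF, ·⟩))
  refine (Finset.card_le_card (by convert hsub)).trans ?_
  refine (Finset.card_union_le _ _).trans (add_le_add ?_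
    ((Finset.card_union_le _ _).trans (add_le_add ?_ ?_)))
  · refine Finset.card_le_one.2 fun I hI J hJ => ?_
    rw [(Finset.mem_filter.1 hI).2, (Finset.mem_filter.1 hJ).2]
  · exact Nat.le_floor (card_le_of_le_abs_entry hδ hT (J := Q) (K := K)
      (fun I hI => hF I (Finset.mem_filter.1 hI).1) fun I hI => (Finset.mem_filter.1 hI).2)
  · exact Nat.le_floor (card_le_of_le_abs_entry' hδ hT (J := Q)
      fun I hI => (Finset.mem_filter.1 hI).2)

end Entries

/-! ### Factorization through an almost diagonal operator -/

/-- The operator `f ↦ ∑_{|I| ≥ 2⁻ⁿ} c_I f_{α I} h_{β I}`. -/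
noncomputable def transfer (n a b : ℕ) (c : DyadicInt → ℝ) (α β : DyadicInt → DyadicInt) :
    SLInftyN a →ₗ[ℝ] SLInftyN b :=
  ∑ I ∈ DyadicInt.upTo n,
    (c I • (coeffHom (α I)).comp (SLInftyN a).subtype).smulRight (haarN b (β I))

theorem transfer_apply (n a b : ℕ) (c : DyadicInt → ℝ) (α β : DyadicInt → DyadicInt)
    (f : SLInftyN a) : transfer n a b c α β f =
      ∑ I ∈ DyadicInt.upTo n, (c I * (f : SLInfty).coeff (α I)) • haarN b (β I) := by
  rw [transfer, LinearMap.sum_apply]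
  rfl

section Factorization

variable {n N : ℕ} {φ : ℕ → DyadicInt}

theorem norm_transfer_le_of_embedding (hφ : DyadicInt.IsEmbedding φ n)
    (hinj : Set.InjOn (fun I : DyadicInt => φ I.enc) (DyadicInt.upTo n)) (f : SLInftyN n) :
    ‖transfer n n N 1 id (fun I => φ I.enc) f‖ ≤ 1 * ‖f‖ := by
  rw [transfer_apply, one_mul]
  refine norm_sum_haarN_le hinj (norm_nonneg f) fun x G hG hx => ?_
  simp only [Pi.one_apply, one_mul, id]
  rcases G.eq_empty_or_nonempty with rfl | hne
  · rw [Finset.sum_empty]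
    positivity
  -- The deepest interval `K` of `G` lies in all the others, so the sum runs along a branch of `f`.
  · obtain ⟨K, hK, hmax⟩ := G.exists_max_image (fun I => I.1) hne
    exact sum_sq_le_norm_sq (f : SLInfty) (K := K) fun I hI =>
      hφ.subset_of_mem (hx I hI) K (hx K hK) (hmax I hI) (DyadicInt.mem_upTo.1 (hG hK))

theorem norm_transfer_le_of_restriction (hφ : DyadicInt.IsEmbedding φ n)
    (hinj : Set.InjOn (fun I : DyadicInt => φ I.enc) (DyadicInt.upTo n)) {c : DyadicInt → ℝ}
    {B : ℝ} (hB : 0 ≤ B) (hc : ∀ I ∈ DyadicInt.upTo n, |c I| ≤ B) (f : SLInftyN N) :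
    ‖transfer n N n c (fun I => φ I.enc) id f‖ ≤ B * ‖f‖ := by
  classical
  rw [transfer_apply]
  refine norm_sum_haarN_le (Set.injOn_id _) (by positivity) fun x G hG hx => ?_
  rcases G.eq_empty_or_nonempty with rfl | hne
  · rw [Finset.sum_empty]
    positivity
  · obtain ⟨K, hK, hmax⟩ := G.exists_max_image (fun I => I.1) hne
    have h1 : ∑ J ∈ G.image (fun I => φ I.enc), (f : SLInfty).coeff J ^ 2 ≤ ‖f‖ ^ 2 := by
      refine sum_sq_le_norm_sq (f : SLInfty) (K := φ K.enc) fun J hJ => ?_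
      obtain ⟨I, hI, rfl⟩ := Finset.mem_image.1 hJ
      exact hφ.subset (hx I hI) K (hx K hK) (hmax I hI) (DyadicInt.mem_upTo.1 (hG hK))
    rw [Finset.sum_image fun I hI J hJ => hinj (hG hI) (hG hJ)] at h1
    calc ∑ I ∈ G, (c I * (f : SLInfty).coeff (φ I.enc)) ^ 2
        ≤ ∑ I ∈ G, B ^ 2 * (f : SLInfty).coeff (φ I.enc) ^ 2 := by
          refine Finset.sum_le_sum fun I hI => ?_
          rw [mul_pow]
          refine mul_le_mul_of_nonneg_right ?_ (sq_nonneg _)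
          rw [← sq_abs]
          exact pow_le_pow_left₀ (abs_nonneg _) (hc I (hG hI)) 2
      _ ≤ (B * ‖f‖) ^ 2 := by
          rw [← Finset.mul_sum, mul_pow]
          exact mul_le_mul_of_nonneg_left h1 (sq_nonneg _)

/-- `R` embeds along `φ`, and `S₀` reads off the coefficients and divides by the diagonal. Then `S₀
H R` is a small perturbation of the identity, and its inverse is absorbed into `S`. -/
theorem exists_factorization (hφ : DyadicInt.IsEmbedding φ n)
    (hinj : Set.InjOn (fun I : DyadicInt => φ I.enc) (DyadicInt.upTo n))
    {H : SLInftyN N →L[ℝ] SLInftyN N} {δ η : ℝ} (hδ : 0 ≤ δ) (hη : 0 < η)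
    (hdiag : ∀ I ∈ DyadicInt.upTo n, 1 / 2 ≤ entry H (φ I.enc) (φ I.enc))
    (hoff : ∀ I ∈ DyadicInt.upTo n, ∀ K ∈ DyadicInt.upTo n, K ≠ I →
      |entry H (φ K.enc) (φ I.enc)| ≤ δ)
    (hδη : (DyadicInt.upTo n).card * (2 * ((DyadicInt.upTo n).card * δ)) ≤ η / (2 + η)) :
    ∃ (R : SLInftyN n →L[ℝ] SLInftyN N) (S : SLInftyN N →L[ℝ] SLInftyN n),
      S ∘L H ∘L R = ContinuousLinearMap.id ℝ (SLInftyN n) ∧ ‖R‖ * ‖S‖ ≤ 2 + η := by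
  classical
  have : CompleteSpace (SLInftyN n) := FiniteDimensional.complete ℝ _
  set q : ℝ := ((DyadicInt.upTo n).card : ℝ) with hq
  set d : DyadicInt → ℝ := fun I => entry H (φ I.enc) (φ I.enc) with hd
  have hdinv : ∀ I ∈ DyadicInt.upTo n, |(d I)⁻¹| ≤ 2 := by
    intro I hI
    have h := hdiag I hI
    rw [abs_of_nonneg (inv_nonneg.2 (by linarith))]
    exact inv_le_of_inv_le₀ (by norm_num) (by linarith)
  set R : SLInftyN n →L[ℝ] SLInftyN N := (transfer n n N 1 id fun I => φ I.enc).mkContinuous 1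
    (norm_transfer_le_of_embedding hφ hinj) with hR
  set S₀ : SLInftyN N →L[ℝ] SLInftyN n :=
    (transfer n N n (fun I => (d I)⁻¹) (fun I => φ I.enc) id).mkContinuous 2
    (norm_transfer_le_of_restriction hφ hinj zero_le_two hdinv) with hS₀
  set U : SLInftyN n →L[ℝ] SLInftyN n := S₀ ∘L H ∘L R with hU
  have hcoeff : ∀ (f : SLInftyN n) (J : DyadicInt), (H (R f) : SLInfty).coeff J =
      ∑ K ∈ DyadicInt.upTo n, (f : SLInfty).coeff K * entry H (φ K.enc) J := by
    intro f J
    rw [hR, LinearMap.mkContinuous_apply, transfer_apply, map_sum,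
      AddSubmonoidClass.coe_finsetSum, coeff_sum]
    refine Finset.sum_congr rfl fun K _ => ?_
    rw [map_smul, Submodule.coe_smul, coeff_smul, Pi.one_apply, one_mul]
    rfl
  -- The diagonal terms cancel exactly. The rest is estimated crudely: each of the `q` coefficients
  -- is at most `2 * (q * δ) * ‖f‖`, and each Haar function has norm at most one.
  have hbound : ∀ f : SLInftyN n, ‖(1 - U) f‖ ≤ η / (2 + η) * ‖f‖ := by
    intro f
    have h1 : (1 - U) f = ∑ I ∈ DyadicInt.upTo n, ((f : SLInfty).coeff I -
        (d I)⁻¹ * (H (R f) : SLInfty).coeff (φ I.enc)) • haarN n I := by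
      simp only [sub_smul, Finset.sum_sub_distrib]
      rw [← eq_sum_haarN f]
      change f - S₀ (H (R f)) = _
      rw [hS₀, LinearMap.mkContinuous_apply, transfer_apply]
      rfl
    have h2 : ∀ I ∈ DyadicInt.upTo n, |(f : SLInfty).coeff I -
        (d I)⁻¹ * (H (R f) : SLInfty).coeff (φ I.enc)| ≤ 2 * (q * δ) * ‖f‖ := by
      intro I hI
      have hd0 : d I ≠ 0 := by
        have := hdiag I hI
        simp only [hd]
        linarith
      rw [hcoeff, ← Finset.add_sum_erase _ _ hI, mul_add, mul_comm (SLInfty.coeff _ I),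
        inv_mul_cancel_left₀ hd0, sub_add_cancel_left, abs_neg, abs_mul, mul_assoc]
      refine mul_le_mul (hdinv I hI) ?_ (abs_nonneg _) zero_le_two
      refine (Finset.abs_sum_le_sum_abs _ _).trans ?_
      refine (Finset.sum_le_card_nsmul _ _ (‖f‖ * δ) fun K hK => ?_).trans ?_
      · rw [abs_mul]
        exact mul_le_mul (abs_coeff_le (f : SLInfty) K)
          (hoff I hI K (Finset.mem_of_mem_erase hK) (Finset.ne_of_mem_erase hK))
          (abs_nonneg _) (norm_nonneg _)
      · rw [nsmul_eq_mul, mul_assoc, mul_comm δ]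
        refine mul_le_mul_of_nonneg_right ?_ (by positivity)
        exact Nat.cast_le.2 (Finset.card_le_card (Finset.erase_subset _ _))
    rw [h1]
    refine (norm_sum_le_of_le _ (f := fun I => ((f : SLInfty).coeff I -
        (d I)⁻¹ * (H (R f) : SLInfty).coeff (φ I.enc)) • haarN n I) fun I hI => ?_).trans
      (b := ∑ I ∈ DyadicInt.upTo n, 2 * (q * δ) * ‖f‖) ?_
    · rw [norm_smul, Real.norm_eq_abs]
      exact (mul_le_of_le_one_right (abs_nonneg _) (norm_haarN_le n I)).trans (h2 I hI)
    · rw [Finset.sum_const, nsmul_eq_mul, ← mul_assoc]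
      exact mul_le_mul_of_nonneg_right hδη (norm_nonneg _)
  have hε : 0 ≤ η / (2 + η) := by positivity
  have hnorm : ‖1 - U‖ ≤ η / (2 + η) := ContinuousLinearMap.opNorm_le_bound _ hε hbound
  -- The threshold `η / (2 + η)` makes the Neumann bound exactly `(2 + η) / 2`, which times `‖S₀‖ ≤
  -- 2` is `2 + η`.
  have hε1 : 1 - η / (2 + η) = 2 / (2 + η) := by field_simp; ring
  have hlt : ‖1 - U‖ < 1 := by
    have : 0 < 2 / (2 + η) := by positivity
    linarith
  have hVU : (∑' i : ℕ, (1 - U) ^ i) * U = 1 := by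
    have := geom_series_mul_neg (1 - U) hlt
    rwa [sub_sub_cancel] at this
  have hV : ‖∑' i : ℕ, (1 - U) ^ i‖ ≤ (2 + η) / 2 := by
    refine (tsum_geometric_le_of_norm_lt_one (1 - U) hlt).trans ?_
    have h1 : ‖(1 : SLInftyN n →L[ℝ] SLInftyN n)‖ ≤ 1 := ContinuousLinearMap.norm_id_le
    have h2 : (1 - ‖1 - U‖)⁻¹ ≤ (2 + η) / 2 := by
      rw [← inv_div]
      exact inv_anti₀ (by positivity) (by linarith)
    linarith
  refine ⟨R, (∑' i : ℕ, (1 - U) ^ i) ∘L S₀, hVU, ?_⟩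
  have hR1 : ‖R‖ ≤ 1 := LinearMap.mkContinuous_norm_le _ zero_le_one _
  have hS2 : ‖S₀‖ ≤ 2 := LinearMap.mkContinuous_norm_le _ zero_le_two _
  calc ‖R‖ * ‖(∑' i : ℕ, (1 - U) ^ i) ∘L S₀‖
      ≤ 1 * ((2 + η) / 2 * 2) := by
        refine mul_le_mul hR1 ((ContinuousLinearMap.opNorm_comp_le _ _).trans ?_)
          (ContinuousLinearMap.opNorm_nonneg _) zero_le_one
        exact mul_le_mul hV hS2 (ContinuousLinearMap.opNorm_nonneg _) (by positivity)
    _ = 2 + η := by ring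

end Factorization

/-! ### Assembly of the theorem -/

theorem DyadicInt.enc_lt_of_mem_upTo {n : ℕ} {I : DyadicInt} (hI : I ∈ upTo n) :
    I.enc < 2 ^ (n + 1) :=
  I.enc_lt.trans_le (Nat.pow_le_pow_right two_pos (Nat.succ_le_succ (mem_upTo.1 hI)))

theorem DyadicInt.enc_injective : Function.Injective enc := by
  intro I K h
  have key : ∀ I K : DyadicInt, I.enc = K.enc → ¬ I.1 < K.1 := fun I K h hlt => by
    have h1 := I.enc_lt
    have h2 : 2 ^ (I.1 + 1) ≤ 2 ^ K.1 := Nat.pow_le_pow_right two_pos hlt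
    have h3 : 2 ^ K.1 ≤ K.enc := Nat.le_add_right _ _
    omega
  have h1 : I.1 = K.1 := le_antisymm (not_lt.1 (key K I h.symm)) (not_lt.1 (key I K h))
  refine ext_val h1 ?_
  simp only [enc, h1] at h
  omega

theorem entry_id_sub {N : ℕ} (T : SLInftyN N →L[ℝ] SLInftyN N) (J K : DyadicInt) :
    entry (ContinuousLinearMap.id ℝ (SLInftyN N) - T) J K =
      (if K = J ∧ J.1 ≤ N then 1 else 0) - entry T J K := by
  rw [← coeff_haarN]
  rfl

theorem mainTheorem2 (n : ℕ) (Γ η : ℝ) (hΓ : 0 < Γ) (hη : 0 < η) :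
    ∃ N : ℕ, ∀ T : SLInftyN N →L[ℝ] SLInftyN N, ‖T‖ ≤ Γ →
      ∃ H : SLInftyN N →L[ℝ] SLInftyN N,
        (H = T ∨ H = ContinuousLinearMap.id ℝ (SLInftyN N) - T) ∧
        ∃ (R : SLInftyN n →L[ℝ] SLInftyN N) (S : SLInftyN N →L[ℝ] SLInftyN n),
          S ∘L H ∘L R = ContinuousLinearMap.id ℝ (SLInftyN n) ∧
          ‖R‖ * ‖S‖ ≤ 2 + η := by
  set q : ℝ := ((DyadicInt.upTo n).card : ℝ) with hq
  have hq0 : 0 < q := by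
    have : 0 < (DyadicInt.upTo n).card :=
      Finset.card_pos.2 ⟨⟨0, 0⟩, DyadicInt.mem_upTo.2 (Nat.zero_le n)⟩
    exact Nat.cast_pos.2 this
  set δ : ℝ := η / (2 + η) / (2 * q ^ 2) with hδdef
  have hδ : 0 < δ := by positivity
  have hδη : q * (2 * (q * δ)) ≤ η / (2 + η) := by
    rw [hδdef]
    field_simp
    exact le_rfl
  -- The positions of intervals of generation at most `n` run from `1` to `2 ^ (n + 1) - 1`;
  -- position `0` is filled but never used.
  obtain ⟨N, hN⟩ := DyadicInt.exists_monochromatic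
    (1 + (⌊Γ ^ 2 / δ ^ 2⌋₊ + ⌊Γ ^ 2 / δ ^ 2⌋₊)) (2 ^ (n + 1))
  refine ⟨N, fun T hT => ?_⟩
  obtain ⟨φ, hmono, hφ⟩ := hN (Interact T δ) (fun J => 1 / 2 ≤ entry T J J)
    (fewBad_interact hδ hT)
  have hlt : ∀ I ∈ DyadicInt.upTo n, I.enc < 2 ^ (n + 1) := fun I hI =>
    DyadicInt.enc_lt_of_mem_upTo hI
  have hlevel : ∀ I ∈ DyadicInt.upTo n, (φ I.enc).1 ≤ N := fun I hI => (hφ _ (hlt I hI)).1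
  have hemb : DyadicInt.IsEmbedding φ n := by
    intro I b hb
    have h1 := (hφ _ (hlt (I.child b) (DyadicInt.mem_upTo.2 hb))).2.1
    have h2 := I.enc_pos
    rw [DyadicInt.enc_child] at h1 ⊢
    have h3 : (2 * I.enc + b.toNat) / 2 = I.enc := by
      cases b
      · simp
      · simp
        omega
    have h4 : decide ((2 * I.enc + b.toNat) % 2 = 1) = b := by cases b <;> simp
    rw [h3, h4] at h1
    exact h1 (by omega)
  have hgood : ∀ I ∈ DyadicInt.upTo n, ∀ K ∈ DyadicInt.upTo n, K ≠ I →
      φ I.enc ≠ φ K.enc ∧ |entry T (φ K.enc) (φ I.enc)| ≤ δ := by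
    intro I hI K hK hne
    rcases lt_or_gt_of_ne fun h => hne (DyadicInt.enc_injective h) with h | h
    · have := (hφ _ (hlt I hI)).2.2 _ h
      simp only [Interact, not_or, not_le] at this
      exact ⟨this.1, this.2.1.le⟩
    -- Here `I` was chosen before `K`, so the entry is controlled by the other direction of
    -- `Interact`.
    · have := (hφ _ (hlt K hK)).2.2 _ h
      simp only [Interact, not_or, not_le] at this
      exact ⟨Ne.symm this.1, this.2.2.le⟩
  have hinj : Set.InjOn (fun I : DyadicInt => φ I.enc) (DyadicInt.upTo n) := by
    intro I hI K hK h
    by_contra hne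
    exact (hgood I hI K hK (Ne.symm hne)).1 h
  rcases hmono with hmono | hmono
  · exact ⟨T, Or.inl rfl, exists_factorization hemb hinj hδ.le hη
      (fun I hI => hmono _ (hlt I hI)) (fun I hI K hK h => (hgood I hI K hK h).2) hδη⟩
  · refine ⟨_, Or.inr rfl, exists_factorization hemb hinj hδ.le hη (fun I hI => ?_)
      (fun I hI K hK h => ?_) hδη⟩
    -- The bound on the generation makes the Haar function at `φ I.enc` nonzero in `SL^∞_N`, so `Id`
    -- has diagonal entry `1` there and that of `Id - T` exceeds `1/2`.
    · have := hmono _ (hlt I hI)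
      rw [entry_id_sub, if_pos ⟨rfl, hlevel I hI⟩]
      linarith
    · obtain ⟨h1, h2⟩ := hgood I hI K hK h
      rw [entry_id_sub, if_neg fun h => h1 h.1, zero_sub, abs_neg]
      exact h2
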